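/- Let $(\Omega,d_\Omega)$, $(\mathcal S,d_{\mathcal S})$, $(\mathcal A,d_{\mathcal A})$ be metric spaces, $\mathcal S,\mathcal A$ with their Borel $\sigma$-algebras, and equip $\mathcal S\times\mathcal A$ with $d_{\mathcal S\times\mathcal A}=d_{\mathcal S}+d_{\mathcal A}$. For each context $\omega\in\Omega$ let $\mathcal M_\omega=\langle\mathcal S,\mathcal A,P_\omega,R_\omega,\gamma,\mu\rangle$ be a Markov decision process with transition kernel $P_\omega$, measurable reward with $|R_\omega|\le R_{\max}$, and common discount factor $\gamma\in[0,1)$ and initial distribution $\mu$. Let $\Theta\subseteq\mathbb R^m$ be open, with $d_\Theta$ the Euclidean distance, and let $\pi_\theta(\cdot\mid s)$, $\theta\in\Theta$, be policies given by positive, jointly measurable densities with respect to a $\sigma$-finite measure on $\mathcal A$. Write $Q_\omega^\theta(s,a)=\mathbb E[\sum_{t\ge0}\gamma^tR_\omega(s_t,a_t)\mid s_0=s,a_0=a]$, $V_\omega^\theta(s)=\mathbb E_{a\sim\pi_\theta(\cdot\mid s)}[Q_\omega^\theta(s,a)]$, let $\delta_{\mu,\omega}^\theta=(1-\gamma)\sum_{t\ge0}\gamma^t\,\mathrm{Law}(s_t)$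 be the discounted state occupancy measure for $s_0\sim\mu$, and let $j_\omega(\theta)=(1-\gamma)\,\mathbb E_{s_0\sim\mu}[V_\omega^\theta(s_0)]$ be the (normalized) expected return. Let $\mathcal K(p,q)=\sup_f|\int f\,dp-\int f\,dq|$, over $1$-Lipschitz $f$ integrable for $p$ and $q$, be the Kantorovich distance. Assume, with non-negative Lipschitz constants, for all $\omega,\widehat\omega\in\Omega$, $s,s'\in\mathcal S$, $a,a'\in\mathcal A$, $\theta,\theta'\in\Theta$ and $i=1,\dots,m$: 1. $\mathcal K(P_\omega(\cdot\mid s,a),P_\omega(\cdot\mid s',a'))\le L_P(\omega)\,d_{\mathcal S\times\mathcal A}((s,a),(s',a'))$ and $|R_\omega(s,a)-R_\omega(s',a')|\le L_r(\omega)\,d_{\mathcal S\times\mathcal A}((s,a),(s',a'))$; 2. $\mathcal K(P_\omega(\cdot\mid s,a),P_{\widehat\omega}(\cdot\mid s,a))\le L_{\omega_P}d_\Omega(\omega,\widehat\omega)$ and $|R_\omega(s,a)-R_{\widehat\omega}(s,a)|\le L_{\omega_r}d_\Omega(\omega,\widehat\omega)$; 3. $\mathcal K(\pi_\theta(\cdot\mid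 s),\pi_\theta(\cdot\mid s'))\le L_{\pi_\theta}d_{\mathcal S}(s,s')$ and $\mathcal K(\pi_\theta(\cdot\mid s),\pi_{\theta'}(\cdot\mid s))\le L_\pi(\theta)d_\Theta(\theta,\theta')$; 4. the partial derivatives $\nabla_{\theta_i}\log\pi_\theta(a\mid s)$ exist, $|\nabla_{\theta_i}\log\pi_\theta(a\mid s)|\le M_\theta^i$, $|\nabla_{\theta_i}\log\pi_\theta(a\mid s)-\nabla_{\theta_i}\log\pi_\theta(a'\mid s')|\le L^i_{\nabla\log\pi_\theta}d_{\mathcal S\times\mathcal A}((s,a),(s',a'))$ and $|\nabla_{\theta_i}\log\pi_\theta(a\mid s)-\nabla_{\theta_i}\log\pi_{\theta'}(a\mid s)|\le L^i_{\nabla\log\pi}(\theta)\,d_\Theta(\theta,\theta')$. Let $\theta\in\Theta$, let $\omega\in\Omega$ be such that $\gamma L_P(\omega)(1+L_{\pi_\theta})<1$, and let $1\le i\le m$. Then, for every context $\omega'\in\Omega$, the partial derivative $\nabla_{\theta_i}j_{\omega'}(\theta)$ exists and equals $\mathbb E_{s\sim\delta_{\mu,\omega'}^\theta,\,a\sim\pi_\theta(\cdot\mid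 s)}[\nabla_{\theta_i}\log\pi_\theta(a\mid s)\,Q_{\omega'}^\theta(s,a)]$, and for every $\widehat\omega\in\Omega$ $$\left|\nabla_{\theta_i}j_\omega(\theta)-\nabla_{\theta_i}j_{\widehat\omega}(\theta)\right|\le L_{\nabla j}(\omega)\,d_\Omega(\omega,\widehat\omega),\qquad L_{\nabla j}(\omega)=L^i_{\eta}(\omega)\,(1+L_{\pi_\theta})\,L_\delta(\omega)+M_\theta^i\,L_{\omega_Q},$$ where $$L_Q(\omega)=\frac{L_r(\omega)}{1-\gamma L_P(\omega)(1+L_{\pi_\theta})},\quad L_V(\omega)=L_Q(\omega)(1+L_{\pi_\theta}),\quad L_{\omega_Q}=\frac{L_{\omega_r}+\gamma L_{\omega_P}L_V(\omega)}{1-\gamma},$$ $$L_\delta(\omega)=\frac{\gamma L_{\omega_P}}{1-\gamma L_P(\omega)(1+L_{\pi_\theta})},\quad L^i_\eta(\omega)=\frac{R_{\max}}{1-\gamma}L^i_{\nabla\log\pi_\theta}+M_\theta^iL_Q(\omega).$$ -/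

import Mathlib

open MeasureTheory ProbabilityTheory
open scoped NNReal ENNReal

noncomputable section

/-- Kantorovich (`L¹`-Wasserstein) distance of two measures in its dual form: the supremum of
`|∫ f dp - ∫ f dq|` over all `1`-Lipschitz real functions `f` for which both integrals exist. -/
def kantorovich {X : Type*} [MetricSpace X] [MeasurableSpace X] (p q : Measure X) : ℝ≥0∞ :=
  ⨆ (f : X → ℝ) (_ : LipschitzWith 1 f) (_ : Integrable f p) (_ : Integrable f q),
    ‖(∫ x, f x ∂p) - ∫ x, f x ∂q‖ₑ

/-- A contextual Markov decision process: a family of MDPs indexed by the context, with common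
state space, action space, discount factor and initial distribution, and bounded rewards. -/
structure CMDP (Ω S A : Type*) [MeasurableSpace S] [MeasurableSpace A] where
  /-- transition kernels `P_ω(· | s, a)` -/
  P : Ω → Kernel (S × A) S
  markov_P : ∀ ω, IsMarkovKernel (P ω)
  /-- reward functions `R_ω(s, a)` -/
  R : Ω → S × A → ℝ
  measurable_R : ∀ ω, Measurable (R ω)
  /-- common bound of the rewards -/
  Rmax : ℝ
  abs_R_le : ∀ ω x, |R ω x| ≤ Rmax
  /-- discount factor -/
  γ : ℝ
  γ_nonneg : 0 ≤ γ
  γ_lt_one : γ < 1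
  /-- initial state distribution -/
  μ : Measure S
  prob_μ : IsProbabilityMeasure μ

/-- A parametric family of stationary Markovian policies, given by positive probability densities
`π_θ(a | s)` with respect to a reference measure on the action space, for `θ` in an open set of
`ℝᵐ`. (Values of `density` for `θ` outside of `Θ` play no role.) -/
structure ParametricPolicy (m : ℕ) (S A : Type*) [MeasurableSpace S] [MeasurableSpace A] where
  /-- parameter space -/
  Θ : Set (EuclideanSpace ℝ (Fin m))
  isOpen_Θ : IsOpen Θ
  /-- reference measure for the densities (for instance Lebesgue or counting measure) -/
  ref : Measure A
  sigmaFinite_ref : SigmaFinite ref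
  /-- the density `π_θ(a | s)` -/
  density : EuclideanSpace ℝ (Fin m) → S → A → ℝ
  measurable_density : ∀ θ ∈ Θ, Measurable (Function.uncurry (density θ))
  density_pos : ∀ θ ∈ Θ, ∀ s a, 0 < density θ s a
  lintegral_density : ∀ θ ∈ Θ, ∀ s, ∫⁻ a, ENNReal.ofReal (density θ s a) ∂ref = 1

namespace ParametricPolicy

variable {m : ℕ} {S A : Type*} [MeasurableSpace S] [MeasurableSpace A]

/-- The policy `π_θ(· | s)` as a kernel from states to actions. -/
def kernel (π : ParametricPolicy m S A) (θ : EuclideanSpace ℝ (Fin m)) : Kernel S A :=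
  haveI := π.sigmaFinite_ref
  Kernel.withDensity (Kernel.const S π.ref) (fun s a => ENNReal.ofReal (π.density θ s a))

/-- The log-density `θ ↦ log π_θ(a | s)`. -/
def logDensity (π : ParametricPolicy m S A) (s : S) (a : A)
    (θ : EuclideanSpace ℝ (Fin m)) : ℝ :=
  Real.log (π.density θ s a)

/-- The `i`-th component of the score `∇_θ log π_θ(a | s)`. -/
def score (π : ParametricPolicy m S A) (i : Fin m) (θ : EuclideanSpace ℝ (Fin m))
    (s : S) (a : A) : ℝ :=
  lineDeriv ℝ (π.logDensity s a) θ (EuclideanSpace.single i 1)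

end ParametricPolicy

namespace CMDP

section values

variable {Ω S A : Type*} [MeasurableSpace S] [MeasurableSpace A] {m : ℕ}

/-- One step of the state-action chain: `(s, a) ↦ (s', a')`, `s' ∼ P_ω(· | s, a)`,
`a' ∼ π_θ(· | s')`. -/
def stepSA (M : CMDP Ω S A) (π : ParametricPolicy m S A) (ω : Ω)
    (θ : EuclideanSpace ℝ (Fin m)) : Kernel (S × A) (S × A) :=
  (Kernel.id ×ₖ π.kernel θ) ∘ₖ M.P ω

/-- The law of `(s_t, a_t)` given `(s_0, a_0)`. -/
def nStepSA (M : CMDP Ω S A) (π : ParametricPolicy m S A) (ω : Ω)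
    (θ : EuclideanSpace ℝ (Fin m)) : ℕ → Kernel (S × A) (S × A)
  | 0 => Kernel.id
  | t + 1 => M.stepSA π ω θ ∘ₖ M.nStepSA π ω θ t

/-- The action-value function `Q_ω^θ(s, a) = ∑ₜ γᵗ E[R_ω(s_t, a_t) | s_0 = s, a_0 = a]`
(an absolutely convergent series, the rewards being bounded). -/
def Q (M : CMDP Ω S A) (π : ParametricPolicy m S A) (ω : Ω)
    (θ : EuclideanSpace ℝ (Fin m)) (s : S) (a : A) : ℝ :=
  ∑' t : ℕ, M.γ ^ t * ∫ x, M.R ω x ∂(M.nStepSA π ω θ t (s, a))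

/-- The state-value function `V_ω^θ(s) = E_{a ∼ π_θ(· | s)}[Q_ω^θ(s, a)]`. -/
def V (M : CMDP Ω S A) (π : ParametricPolicy m S A) (ω : Ω)
    (θ : EuclideanSpace ℝ (Fin m)) (s : S) : ℝ :=
  ∫ a, M.Q π ω θ s a ∂(π.kernel θ s)

/-- The expected (unnormalized) discounted return `j_ω(θ) = E_{s_0 ∼ μ}[V_ω^θ(s_0)]`. -/
def expectedReturn (M : CMDP Ω S A) (π : ParametricPolicy m S A) (ω : Ω)
    (θ : EuclideanSpace ℝ (Fin m)) : ℝ :=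
  ∫ s, M.V π ω θ s ∂M.μ

/-- One step of the state chain: `a ∼ π_θ(· | s)`, `s' ∼ P_ω(· | s, a)`. -/
def stepS (M : CMDP Ω S A) (π : ParametricPolicy m S A) (ω : Ω)
    (θ : EuclideanSpace ℝ (Fin m)) : Kernel S S :=
  M.P ω ∘ₖ (Kernel.id ×ₖ π.kernel θ)

/-- The law of the state `s_t` when `s_0 ∼ μ`. -/
def stateLaw (M : CMDP Ω S A) (π : ParametricPolicy m S A) (ω : Ω)
    (θ : EuclideanSpace ℝ (Fin m)) : ℕ → Measure S
  | 0 => M.μ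
  | t + 1 => (M.stateLaw π ω θ t).bind (M.stepS π ω θ)

/-- The `γ`-discounted state occupancy measure
`δ_{μ,ω}^θ = (1 - γ) ∑ₜ γᵗ Law(s_t)`. -/
def occupancy (M : CMDP Ω S A) (π : ParametricPolicy m S A) (ω : Ω)
    (θ : EuclideanSpace ℝ (Fin m)) : Measure S :=
  ENNReal.ofReal (1 - M.γ) •
    Measure.sum (fun t : ℕ => ENNReal.ofReal (M.γ ^ t) • M.stateLaw π ω θ t)

/-- `η_{i,ω}^θ(s, a) = ∇_{θ_i} log π_θ(a | s) · Q_ω^θ(s, a)`. -/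
def eta (M : CMDP Ω S A) (π : ParametricPolicy m S A) (i : Fin m) (ω : Ω)
    (θ : EuclideanSpace ℝ (Fin m)) (s : S) (a : A) : ℝ :=
  π.score i θ s a * M.Q π ω θ s a

/-- The policy gradient `E_{s ∼ δ_{μ,ω}^θ, a ∼ π_θ(· | s)}[∇_{θ_i} log π_θ(a | s) Q_ω^θ(s, a)]`,
`i`-th component. -/
def policyGradient (M : CMDP Ω S A) (π : ParametricPolicy m S A) (i : Fin m) (ω : Ω)
    (θ : EuclideanSpace ℝ (Fin m)) : ℝ :=
  ∫ s, ∫ a, M.eta π i ω θ s a ∂(π.kernel θ s) ∂(M.occupancy π ω θ)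

end values

section lipschitz

variable {Ω S A : Type*} [MetricSpace S] [MeasurableSpace S] [MetricSpace A] [MeasurableSpace A]

/-- Every MDP of the family is `(L_P(ω), L_r(ω))`-Lipschitz; the metric on state-action pairs is
`d_S + d_A`. -/
structure IsLipschitz (M : CMDP Ω S A) (LP Lr : Ω → ℝ≥0) : Prop where
  transition : ∀ ω s s' a a',
    kantorovich (M.P ω (s, a)) (M.P ω (s', a')) ≤ LP ω * (edist s s' + edist a a')
  reward : ∀ ω s s' a a',
    |M.R ω (s, a) - M.R ω (s', a')| ≤ Lr ω * (dist s s' + dist a a')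

/-- The family of MDPs is `(L_{ωP}, L_{ωr})`-Lipschitz in the context. -/
structure IsContextLipschitz [MetricSpace Ω] (M : CMDP Ω S A) (LωP Lωr : ℝ≥0) : Prop where
  transition : ∀ ω ω' s a,
    kantorovich (M.P ω (s, a)) (M.P ω' (s, a)) ≤ LωP * edist ω ω'
  reward : ∀ ω ω' s a,
    |M.R ω (s, a) - M.R ω' (s, a)| ≤ Lωr * dist ω ω'

end lipschitz

end CMDP

namespace ParametricPolicy

variable {m : ℕ} {S A : Type*} [MetricSpace S] [MeasurableSpace S]
  [MetricSpace A] [MeasurableSpace A]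

/-- The policy is Lipschitz in the state, with constant `L_{π_θ}`, and in the parameter, with
constant `L_π(θ)`. -/
structure IsLipschitz (π : ParametricPolicy m S A)
    (Lstate Lparam : EuclideanSpace ℝ (Fin m) → ℝ≥0) : Prop where
  state : ∀ θ ∈ π.Θ, ∀ s s',
    kantorovich (π.kernel θ s) (π.kernel θ s') ≤ Lstate θ * edist s s'
  param : ∀ s, ∀ θ ∈ π.Θ, ∀ θ' ∈ π.Θ,
    kantorovich (π.kernel θ s) (π.kernel θ' s) ≤ Lparam θ * edist θ θ'

/-- The partial derivatives `∇_{θ_i} log π_θ(a | s)` exist, are bounded by `M_θ^i`, Lipschitz in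
the state-action pair with constant `Lsa θ i`, and Lipschitz in the parameter with constant
`Lparam θ i`. -/
structure HasLipschitzScore (π : ParametricPolicy m S A)
    (B : EuclideanSpace ℝ (Fin m) → Fin m → ℝ)
    (Lsa Lparam : EuclideanSpace ℝ (Fin m) → Fin m → ℝ≥0) : Prop where
  differentiable : ∀ θ ∈ π.Θ, ∀ i s a,
    LineDifferentiableAt ℝ (π.logDensity s a) θ (EuclideanSpace.single i 1)
  bounded : ∀ θ ∈ π.Θ, ∀ i s a, |π.score i θ s a| ≤ B θ i
  stateAction : ∀ θ ∈ π.Θ, ∀ i s s' a a',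
    |π.score i θ s a - π.score i θ s' a'| ≤ Lsa θ i * (dist s s' + dist a a')
  param : ∀ θ ∈ π.Θ, ∀ θ' ∈ π.Θ, ∀ i s a,
    |π.score i θ s a - π.score i θ' s a| ≤ Lparam θ i * dist θ θ'

end ParametricPolicy

/-- `L_Q = L_r / (1 - γ L_P (1 + L_π))`. -/
def lipQ (γ LP Lr Lπ : ℝ) : ℝ := Lr / (1 - γ * LP * (1 + Lπ))

/-- `L_V = L_Q (1 + L_π)`. -/
def lipV (γ LP Lr Lπ : ℝ) : ℝ := lipQ γ LP Lr Lπ * (1 + Lπ)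

/-- `L_{ωQ} = (L_{ωr} + γ L_{ωP} L_V) / (1 - γ)`. -/
def lipCtxQ (γ LP Lr Lπ LωP Lωr : ℝ) : ℝ := (Lωr + γ * LωP * lipV γ LP Lr Lπ) / (1 - γ)

/-- `L_δ = γ L_{ωP} / (1 - γ L_P (1 + L_π))`. -/
def lipDelta (γ LP Lπ LωP : ℝ) : ℝ := γ * LωP / (1 - γ * LP * (1 + Lπ))

/-- `L_η = (R_max / (1 - γ)) L_{∇log π} + B L_Q`, where `B` is the bound of the score. -/
def lipEta (γ Rmax LP Lr Lπ B Lscore : ℝ) : ℝ :=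
  Rmax / (1 - γ) * Lscore + B * lipQ γ LP Lr Lπ

/-- `L_{∇j} = L_η (1 + L_π) L_δ + B L_{ωQ}`. -/
def lipGrad (γ Rmax LP Lr Lπ LωP Lωr B Lscore : ℝ) : ℝ :=
  lipEta γ Rmax LP Lr Lπ B Lscore * (1 + Lπ) * lipDelta γ LP Lπ LωP
    + B * lipCtxQ γ LP Lr Lπ LωP Lωr

end

/-! Both claims rest on resolvent equations `G = g + γ T G` for a Markov operator `T`, tested only
on bounded measurable functions, a class stable under kernels on which every integral exists.

Lipschitz bound. If `T` multiplies Lipschitz constants by at most `k` and `γ k < 1`, the bounded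
solution `G` has constant `ℓ / (1 - γ k)` whenever `g` has constant `ℓ` (`lipschitz_of_fixedPoint`).
Averaging over the action costs a factor `1 + Lπ` and the transition costs `LP`, so `k = LP (1 +
Lπ)` both for pairs and for states. On pairs, with `g = R`, this gives the regularity of `Q`. On
states it gives the regularity of the function dual to the occupancy measure: `∫ g dδ = (1 - γ) ∫ G
dμ`, hence a change of context moves `∫ g dδ` by `γ ∫ (T' - T) G dδ'`. The gradient is `∫ g dδ` with
`g` the action average of the score times `Q`. It is compared by first changing `δ` with `g` fixed,
then changing `Q` under the new measure. Every Lipschitz test function belongs to the context `ω`,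
so the second context needs no contraction.

Policy gradient. The ratio of the densities at `θ + h e_i` and `θ` is `1 + h * score + O(h²)`,
uniformly in `(s, a)`. The performance difference identity writes the change of the return exactly
as an integral, under the occupancy and policy of `θ`, of the perturbed `Q` times (ratio `- 1`). As
`Q` itself changes by `O(h)`, replacing it by the unperturbed one costs `O(h²)`; no derivative of
`Q` and no exchange of derivative and integral is needed. -/

/-- A measurable real function bounded in absolute value by `C`. -/
structure IsBoundedMeasurable {X : Type*} [MeasurableSpace X] (f : X → ℝ) (C : ℝ) : Prop where
  measurable : Measurable f
  abs_le : ∀ x, |f x| ≤ C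

namespace IsBoundedMeasurable

variable {X Y : Type*} [MeasurableSpace X] [MeasurableSpace Y] {f g : X → ℝ} {C D : ℝ}

theorem integrable (hf : IsBoundedMeasurable f C) (μ : Measure X) [IsFiniteMeasure μ] :
    Integrable f μ :=
  Integrable.of_bound hf.measurable.aestronglyMeasurable C
    (Filter.Eventually.of_forall fun x => by simpa using hf.abs_le x)

theorem abs_integral_le (hf : IsBoundedMeasurable f C) (μ : Measure X) [IsProbabilityMeasure μ] :
    |∫ x, f x ∂μ| ≤ C := by
  have h := norm_integral_le_of_norm_le_const (μ := μ) (f := f) (C := C)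
    (Filter.Eventually.of_forall fun x => by simpa using hf.abs_le x)
  simpa using h

theorem add (hf : IsBoundedMeasurable f C) (hg : IsBoundedMeasurable g D) :
    IsBoundedMeasurable (fun x => f x + g x) (C + D) :=
  ⟨hf.measurable.add hg.measurable,
    fun x => (abs_add_le _ _).trans (add_le_add (hf.abs_le x) (hg.abs_le x))⟩

theorem sub (hf : IsBoundedMeasurable f C) (hg : IsBoundedMeasurable g D) :
    IsBoundedMeasurable (fun x => f x - g x) (C + D) :=
  ⟨hf.measurable.sub hg.measurable,
    fun x => (abs_sub _ _).trans (add_le_add (hf.abs_le x) (hg.abs_le x))⟩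

theorem mul (hf : IsBoundedMeasurable f C) (hg : IsBoundedMeasurable g D) :
    IsBoundedMeasurable (fun x => f x * g x) (C * D) :=
  ⟨hf.measurable.mul hg.measurable, fun x => by
    rw [abs_mul]
    exact mul_le_mul (hf.abs_le x) (hg.abs_le x) (abs_nonneg _)
      ((abs_nonneg _).trans (hf.abs_le x))⟩

theorem const_mul (hf : IsBoundedMeasurable f C) (c : ℝ) :
    IsBoundedMeasurable (fun x => c * f x) (|c| * C) :=
  ⟨hf.measurable.const_mul c, fun x => by
    rw [abs_mul]; exact mul_le_mul_of_nonneg_left (hf.abs_le x) (abs_nonneg _)⟩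

theorem comp (hf : IsBoundedMeasurable f C) {φ : Y → X} (hφ : Measurable φ) :
    IsBoundedMeasurable (fun y => f (φ y)) C :=
  ⟨hf.measurable.comp hφ, fun y => hf.abs_le (φ y)⟩

theorem mono (hf : IsBoundedMeasurable f C) (h : ∀ x, |f x| ≤ D) : IsBoundedMeasurable f D :=
  ⟨hf.measurable, h⟩

theorem integral_kernel (hf : IsBoundedMeasurable f C) (κ : Kernel Y X) [IsMarkovKernel κ] :
    IsBoundedMeasurable (fun y => ∫ x, f x ∂(κ y)) C :=
  ⟨hf.measurable.stronglyMeasurable.integral_kernel.measurable, fun y => hf.abs_integral_le (κ y)⟩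

theorem integral_kernel_prod {f : Y × X → ℝ} (hf : IsBoundedMeasurable f C)
    (κ : Kernel Y X) [IsMarkovKernel κ] :
    IsBoundedMeasurable (fun y => ∫ x, f (y, x) ∂(κ y)) C :=
  ⟨hf.measurable.stronglyMeasurable.integral_kernel_prod_right'.measurable,
    fun y => (hf.comp measurable_prodMk_left).abs_integral_le (κ y)⟩

theorem integral_comp {Z : Type*} [MeasurableSpace Z] (hf : IsBoundedMeasurable f C)
    (η : Kernel Y X) [IsMarkovKernel η] (κ : Kernel Z Y) [IsMarkovKernel κ] (z : Z) :
    ∫ x, f x ∂((η ∘ₖ κ) z) = ∫ y, ∫ x, f x ∂(η y) ∂(κ z) :=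
  Kernel.integral_comp (hf.integrable _)

theorem integral_bind (hf : IsBoundedMeasurable f C)
    (η : Kernel Y X) [IsMarkovKernel η] (μ : Measure Y) [IsProbabilityMeasure μ] :
    ∫ x, f x ∂(μ.bind η) = ∫ y, ∫ x, f x ∂(η y) ∂μ :=
  hf.integral_comp η (Kernel.const Unit μ) ()

theorem integral_id_prod {f : Y × X → ℝ} (hf : IsBoundedMeasurable f C)
    (κ : Kernel Y X) [IsMarkovKernel κ] (y : Y) :
    ∫ z, f z ∂((Kernel.id ×ₖ κ) y) = ∫ x, f (y, x) ∂(κ y) := by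
  rw [Kernel.prod_apply, Kernel.id_apply, integral_prod _ (hf.integrable _), integral_dirac']
  exact hf.measurable.stronglyMeasurable.integral_prod_right'

end IsBoundedMeasurable

/-! ### Discounted sums along a Markov chain -/

/-- A bounded function whose every bound `b` improves to `c + γ b` is bounded by `c / (1 - γ)`. -/
theorem abs_le_div_one_sub_of_forall_bound {X : Type*} {f : X → ℝ} {C c γ : ℝ}
    (hC : ∀ x, |f x| ≤ C) (hγ : γ < 1)
    (h : ∀ b, (∀ x, |f x| ≤ b) → ∀ x, |f x| ≤ c + γ * b) (x : X) : |f x| ≤ c / (1 - γ) := by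
  have hbdd : BddAbove (Set.range fun y => |f y|) := ⟨C, by rintro _ ⟨y, rfl⟩; exact hC y⟩
  have hsup : ∀ y, |f y| ≤ ⨆ y, |f y| := fun y => le_ciSup hbdd y
  have : Nonempty X := ⟨x⟩
  -- The supremum is itself an admissible bound, so the improvement applies to it.
  have h1 : (⨆ y, |f y|) ≤ c + γ * ⨆ y, |f y| := ciSup_le (h _ hsup)
  rw [le_div_iff₀ (by linarith)]
  nlinarith [hsup x]

/-- The `t`-th iterate of a kernel. -/
noncomputable def iterKernel {X : Type*} [MeasurableSpace X] (κ : Kernel X X) : ℕ → Kernel X X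
  | 0 => Kernel.id
  | t + 1 => κ ∘ₖ iterKernel κ t

/-- The discounted sum `∑ₜ γᵗ E[g(x_t) | x_0 = x]` along the Markov chain with kernel `κ`. -/
noncomputable def discountedSum {X : Type*} [MeasurableSpace X] (κ : Kernel X X) (γ : ℝ)
    (g : X → ℝ) (x : X) : ℝ :=
  ∑' t : ℕ, γ ^ t * ∫ y, g y ∂(iterKernel κ t x)

section discounted

variable {X : Type*} [MeasurableSpace X] (κ : Kernel X X) [IsMarkovKernel κ]
  {γ C : ℝ} {g : X → ℝ}

instance isMarkovKernel_iterKernel (t : ℕ) : IsMarkovKernel (iterKernel κ t) := by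
  induction t with
  | zero => exact inferInstanceAs (IsMarkovKernel Kernel.id)
  | succ t ih => exact inferInstanceAs (IsMarkovKernel (κ ∘ₖ iterKernel κ t))

-- The recursion adds a step at the end of the path; the Bellman equation has to split off the first
-- one.
omit [IsMarkovKernel κ] in
theorem iterKernel_succ' (t : ℕ) : iterKernel κ (t + 1) = iterKernel κ t ∘ₖ κ := by
  induction t with
  | zero => simp [iterKernel]
  | succ t ih =>
    change κ ∘ₖ iterKernel κ (t + 1) = (κ ∘ₖ iterKernel κ t) ∘ₖ κ
    rw [Kernel.comp_assoc, ih]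

theorem abs_discounted_term_le (hγ0 : 0 ≤ γ) (hg : IsBoundedMeasurable g C) (t : ℕ) (x : X) :
    |γ ^ t * ∫ y, g y ∂(iterKernel κ t x)| ≤ γ ^ t * C := by
  rw [abs_mul, abs_of_nonneg (pow_nonneg hγ0 t)]
  exact mul_le_mul_of_nonneg_left (hg.abs_integral_le _) (pow_nonneg hγ0 t)

theorem summable_discounted (hγ0 : 0 ≤ γ) (hγ1 : γ < 1) (hg : IsBoundedMeasurable g C) (x : X) :
    Summable fun t : ℕ => γ ^ t * ∫ y, g y ∂(iterKernel κ t x) :=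
  Summable.of_norm_bounded ((summable_geometric_of_lt_one hγ0 hγ1).mul_right C)
    (abs_discounted_term_le κ hγ0 hg · x)

theorem isBoundedMeasurable_discountedSum (hγ0 : 0 ≤ γ) (hγ1 : γ < 1)
    (hg : IsBoundedMeasurable g C) :
    IsBoundedMeasurable (discountedSum κ γ g) (C / (1 - γ)) where
  measurable := by
    refine measurable_of_tendsto_metrizable (fun n : ℕ => ?_)
      (tendsto_pi_nhds.2 fun x => (summable_discounted κ hγ0 hγ1 hg x).hasSum.tendsto_sum_nat)
    exact Finset.measurable_sum _ fun t _ =>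
      ((hg.integral_kernel (iterKernel κ t)).const_mul (γ ^ t)).measurable
  abs_le x := by
    have hs := ((hasSum_geometric_of_lt_one hγ0 hγ1).mul_right C)
    rw [div_eq_inv_mul, discountedSum, ← Real.norm_eq_abs]
    exact tsum_of_norm_bounded hs fun t => abs_discounted_term_le κ hγ0 hg t x

/-- The Bellman equation. -/
theorem discountedSum_eq (hγ0 : 0 ≤ γ) (hγ1 : γ < 1) (hg : IsBoundedMeasurable g C) (x : X) :
    discountedSum κ γ g x = g x + γ * ∫ y, discountedSum κ γ g y ∂(κ x) := by
  have hb : ∀ t : ℕ, IsBoundedMeasurable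
      (fun y => γ ^ t * ∫ z, g z ∂(iterKernel κ t y)) (γ ^ t * C) := fun t =>
    ((hg.integral_kernel (iterKernel κ t)).const_mul (γ ^ t)).mono
      fun y => abs_discounted_term_le κ hγ0 hg t y
  have hsum : Summable fun t : ℕ => ∫ y, ‖γ ^ t * ∫ z, g z ∂(iterKernel κ t y)‖ ∂(κ x) := by
    refine Summable.of_norm_bounded ((summable_geometric_of_lt_one hγ0 hγ1).mul_right C) fun t => ?_
    exact IsBoundedMeasurable.abs_integral_le
      ⟨(hb t).measurable.norm, fun y => by simpa using (hb t).abs_le y⟩ (κ x)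
  have hint : ∫ y, discountedSum κ γ g y ∂(κ x)
      = ∑' t : ℕ, γ ^ t * ∫ z, g z ∂(iterKernel κ (t + 1) x) := by
    unfold discountedSum
    rw [← integral_tsum_of_summable_integral_norm (fun t => (hb t).integrable _) hsum]
    refine tsum_congr fun t => ?_
    rw [integral_const_mul, iterKernel_succ', hg.integral_comp]
  rw [hint, ← tsum_mul_left, discountedSum, (summable_discounted κ hγ0 hγ1 hg x).tsum_eq_zero_add]
  congr 1
  · simp [iterKernel, Kernel.id_apply, integral_dirac' _ _ hg.measurable.stronglyMeasurable]
  · exact tsum_congr fun t => by ring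

/-- If a Markov kernel multiplies Lipschitz constants (with respect to `d`) by at most `k` and
`γ k < 1`, then a bounded solution of `G = g + γ κ G` is Lipschitz whenever `g` is. -/
theorem lipschitz_of_fixedPoint {d : X → X → ℝ} (hd : ∀ x y, 0 ≤ d x y) {k ℓ D : ℝ}
    {G : X → ℝ} (hγ0 : 0 ≤ γ) (hγ1 : γ < 1) (hγk : γ * k < 1) (hℓ : 0 ≤ ℓ)
    (hκ : ∀ (f : X → ℝ) (b c : ℝ), 0 ≤ c → IsBoundedMeasurable f b →
      (∀ x y, |f x - f y| ≤ c * d x y) →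
      ∀ x y, |∫ z, f z ∂(κ x) - ∫ z, f z ∂(κ y)| ≤ k * c * d x y)
    (hg : IsBoundedMeasurable g C) (hgl : ∀ x y, |g x - g y| ≤ ℓ * d x y)
    (hG : IsBoundedMeasurable G D) (hfix : ∀ x, G x = g x + γ * ∫ y, G y ∂(κ x)) (x y : X) :
    |G x - G y| ≤ ℓ / (1 - γ * k) * d x y := by
  have hpos : 0 < 1 - γ * k := by linarith
  -- Value iteration from `0`: each iterate keeps the target constant and the error shrinks by `γ`.
  -- This avoids assuming beforehand that `G` is Lipschitz.
  have key : ∀ n : ℕ, ∃ (F : X → ℝ) (b : ℝ), IsBoundedMeasurable F b ∧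
      (∀ x y, |F x - F y| ≤ ℓ / (1 - γ * k) * d x y) ∧ ∀ x, |F x - G x| ≤ γ ^ n * D := by
    intro n
    induction n with
    | zero =>
      refine ⟨fun _ => 0, 0, ⟨measurable_const, by simp⟩, fun x y => ?_, fun x => ?_⟩
      · simpa using mul_nonneg (div_nonneg hℓ hpos.le) (hd x y)
      · simpa using hG.abs_le x
    | succ n ih =>
      obtain ⟨F, b, hF, hFl, hFG⟩ := ih
      refine ⟨fun x => g x + γ * ∫ y, F y ∂(κ x), _,
        hg.add ((hF.integral_kernel κ).const_mul γ), fun x y => ?_, fun x => ?_⟩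
      · have h1 := hκ F b _ (div_nonneg hℓ hpos.le) hF hFl x y
        -- The target constant is the fixed point of `L = ℓ + γ k L`.
        have h2 : ℓ / (1 - γ * k) * d x y
            = ℓ * d x y + γ * (k * (ℓ / (1 - γ * k)) * d x y) := by
          field_simp; ring
        rw [h2]
        calc _ = |(g x - g y) + γ * (∫ z, F z ∂(κ x) - ∫ z, F z ∂(κ y))| := by ring_nf
          _ ≤ |g x - g y| + |γ * (∫ z, F z ∂(κ x) - ∫ z, F z ∂(κ y))| := abs_add_le _ _
          _ ≤ _ := by
            rw [abs_mul, abs_of_nonneg hγ0]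
            exact add_le_add (hgl x y) (mul_le_mul_of_nonneg_left h1 hγ0)
      · rw [hfix x, add_sub_add_left_eq_sub, ← mul_sub,
          ← integral_sub (hF.integrable _) (hG.integrable _), abs_mul, abs_of_nonneg hγ0,
          pow_succ', mul_assoc]
        exact mul_le_mul_of_nonneg_left
          (((hF.sub hG).mono hFG).abs_integral_le (κ x)) hγ0
  -- The factor `2` counts the approximation errors at `x` and at `y`.
  have hlim : Filter.Tendsto (fun n : ℕ => ℓ / (1 - γ * k) * d x y + 2 * (γ ^ n * D))
      Filter.atTop (nhds (ℓ / (1 - γ * k) * d x y)) := by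
    have h0 := (tendsto_pow_atTop_nhds_zero_of_lt_one hγ0 hγ1).mul_const D
    simpa using (h0.const_mul 2).const_add (ℓ / (1 - γ * k) * d x y)
  refine ge_of_tendsto' hlim fun n => ?_
  obtain ⟨F, b, -, hFl, hFG⟩ := key n
  have h1 := abs_le.1 (hFl x y)
  have h2 := abs_le.1 (hFG x)
  have h3 := abs_le.1 (hFG y)
  rw [abs_le]
  constructor <;> linarith [h1.1, h1.2, h2.1, h2.2, h3.1, h3.2]

end discounted

/-! ### Kantorovich duality and policy kernels -/

/-- Test functions with Lipschitz constant `ℓ` are controlled by the Kantorovich distance. -/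
theorem abs_integral_sub_le_of_kantorovich_le {X : Type*} [MetricSpace X] [MeasurableSpace X]
    {p q : Measure X} [IsProbabilityMeasure p] [IsProbabilityMeasure q]
    {c ℓ C : ℝ} (hc : 0 ≤ c) (hpq : kantorovich p q ≤ ENNReal.ofReal c) (hℓ : 0 ≤ ℓ)
    {f : X → ℝ} (hf : IsBoundedMeasurable f C) (hfl : ∀ x y, |f x - f y| ≤ ℓ * dist x y) :
    |∫ x, f x ∂p - ∫ x, f x ∂q| ≤ ℓ * c := by
  rcases hℓ.eq_or_lt with rfl | hpos
  -- For `ℓ = 0` rescaling by `ℓ⁻¹` is unavailable, but `f` is constant and both measures have mass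
  -- one.
  · obtain ⟨x₀⟩ : Nonempty X := Measure.nonempty_of_neZero p
    have hconst : f = fun _ => f x₀ := by
      funext x
      have := hfl x x₀
      rw [zero_mul, abs_nonpos_iff, sub_eq_zero] at this
      exact this
    rw [hconst]
    simp
  · have hlip : LipschitzWith 1 (fun x => ℓ⁻¹ * f x) := by
      refine LipschitzWith.of_dist_le_mul fun x y => ?_
      rw [Real.dist_eq, ← mul_sub, abs_mul, abs_of_pos (inv_pos.2 hpos), NNReal.coe_one, one_mul,
        inv_mul_le_iff₀ hpos]
      exact hfl x y
    have hb := hf.const_mul ℓ⁻¹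
    have h1 : ‖(∫ x, ℓ⁻¹ * f x ∂p) - ∫ x, ℓ⁻¹ * f x ∂q‖ₑ ≤ ENNReal.ofReal c := by
      refine le_trans ?_ hpq
      unfold kantorovich
      exact le_iSup_of_le (fun x => ℓ⁻¹ * f x) (le_iSup_of_le hlip
        (le_iSup_of_le (hb.integrable p) (le_iSup_of_le (hb.integrable q) le_rfl)))
    rw [Real.enorm_eq_ofReal_abs, ENNReal.ofReal_le_ofReal_iff hc, integral_const_mul,
      integral_const_mul, ← mul_sub, abs_mul, abs_of_pos (inv_pos.2 hpos),
      inv_mul_le_iff₀ hpos] at h1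
    exact h1

theorem ParametricPolicy.kernel_apply {m : ℕ} {S A : Type*} [MeasurableSpace S]
    [MeasurableSpace A] (π : ParametricPolicy m S A) {θ : EuclideanSpace ℝ (Fin m)}
    (hθ : θ ∈ π.Θ) (s : S) :
    π.kernel θ s = π.ref.withDensity fun a => ENNReal.ofReal (π.density θ s a) := by
  have := π.sigmaFinite_ref
  unfold ParametricPolicy.kernel
  rw [Kernel.withDensity_apply _ (π.measurable_density θ hθ).ennreal_ofReal, Kernel.const_apply]

theorem ParametricPolicy.isMarkovKernel_kernel {m : ℕ} {S A : Type*} [MeasurableSpace S]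
    [MeasurableSpace A] (π : ParametricPolicy m S A) {θ : EuclideanSpace ℝ (Fin m)}
    (hθ : θ ∈ π.Θ) : IsMarkovKernel (π.kernel θ) := by
  refine ⟨fun s => ⟨?_⟩⟩
  rw [π.kernel_apply hθ, withDensity_apply _ MeasurableSet.univ, setLIntegral_univ]
  exact π.lintegral_density θ hθ s

/-! ### Bellman equations and the occupancy measure -/

namespace CMDP

variable {Ω S A : Type*} [MeasurableSpace S] [MeasurableSpace A] {m : ℕ}
  (M : CMDP Ω S A) (π : ParametricPolicy m S A) (ω : Ω) (θ : EuclideanSpace ℝ (Fin m))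

instance isMarkovKernel_P : IsMarkovKernel (M.P ω) := M.markov_P ω

instance isProbabilityMeasure_μ : IsProbabilityMeasure M.μ := M.prob_μ

theorem one_sub_γ_pos : 0 < 1 - M.γ := sub_pos.2 M.γ_lt_one

theorem isBoundedMeasurable_R : IsBoundedMeasurable (M.R ω) M.Rmax :=
  ⟨M.measurable_R ω, M.abs_R_le ω⟩

variable [IsMarkovKernel (π.kernel θ)]

instance isMarkovKernel_stepSA : IsMarkovKernel (M.stepSA π ω θ) :=
  inferInstanceAs (IsMarkovKernel ((Kernel.id ×ₖ π.kernel θ) ∘ₖ M.P ω))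

instance isMarkovKernel_stepS : IsMarkovKernel (M.stepS π ω θ) :=
  inferInstanceAs (IsMarkovKernel (M.P ω ∘ₖ (Kernel.id ×ₖ π.kernel θ)))

theorem integral_stepSA {f : S × A → ℝ} {C : ℝ} (hf : IsBoundedMeasurable f C) (x : S × A) :
    ∫ y, f y ∂(M.stepSA π ω θ x) = ∫ s, ∫ a, f (s, a) ∂(π.kernel θ s) ∂(M.P ω x) := by
  unfold stepSA
  rw [hf.integral_comp]
  exact integral_congr_ae (Filter.Eventually.of_forall fun s => hf.integral_id_prod _ s)

theorem integral_stepS {f : S → ℝ} {C : ℝ} (hf : IsBoundedMeasurable f C) (s : S) :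
    ∫ y, f y ∂(M.stepS π ω θ s) = ∫ a, ∫ y, f y ∂(M.P ω (s, a)) ∂(π.kernel θ s) := by
  unfold stepS
  rw [hf.integral_comp, (hf.integral_kernel (M.P ω)).integral_id_prod]

omit [IsMarkovKernel (π.kernel θ)] in
theorem nStepSA_eq_iterKernel (t : ℕ) :
    M.nStepSA π ω θ t = iterKernel (M.stepSA π ω θ) t := by
  induction t with
  | zero => rfl
  | succ t ih => simp only [nStepSA, iterKernel, ih]

omit [IsMarkovKernel (π.kernel θ)] in
theorem Q_eq_discountedSum (s : S) (a : A) :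
    M.Q π ω θ s a = discountedSum (M.stepSA π ω θ) M.γ (M.R ω) (s, a) := by
  simp only [Q, discountedSum, nStepSA_eq_iterKernel]

theorem isBoundedMeasurable_Q :
    IsBoundedMeasurable (fun x : S × A => M.Q π ω θ x.1 x.2) (M.Rmax / (1 - M.γ)) := by
  simpa only [Q_eq_discountedSum] using
    isBoundedMeasurable_discountedSum (M.stepSA π ω θ) M.γ_nonneg M.γ_lt_one
      (M.isBoundedMeasurable_R ω)

theorem isBoundedMeasurable_V : IsBoundedMeasurable (M.V π ω θ) (M.Rmax / (1 - M.γ)) :=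
  (M.isBoundedMeasurable_Q π ω θ).integral_kernel_prod (π.kernel θ)

theorem Q_eq_stepSA (x : S × A) :
    M.Q π ω θ x.1 x.2 = M.R ω x + M.γ * ∫ y, M.Q π ω θ y.1 y.2 ∂(M.stepSA π ω θ x) := by
  simpa only [Q_eq_discountedSum] using
    discountedSum_eq (M.stepSA π ω θ) M.γ_nonneg M.γ_lt_one (M.isBoundedMeasurable_R ω) x

theorem Q_eq (s : S) (a : A) :
    M.Q π ω θ s a = M.R ω (s, a) + M.γ * ∫ s', M.V π ω θ s' ∂(M.P ω (s, a)) := by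
  rw [M.Q_eq_stepSA π ω θ (s, a), M.integral_stepSA π ω θ (M.isBoundedMeasurable_Q π ω θ)]
  rfl

instance isProbabilityMeasure_stateLaw (t : ℕ) :
    IsProbabilityMeasure (M.stateLaw π ω θ t) := by
  induction t with
  | zero => exact M.prob_μ
  | succ t ih => exact inferInstanceAs (IsProbabilityMeasure (M.stepS π ω θ ∘ₘ M.stateLaw π ω θ t))

instance isProbabilityMeasure_occupancy : IsProbabilityMeasure (M.occupancy π ω θ) := by
  constructor
  have hγ := M.one_sub_γ_pos
  simp only [occupancy, Measure.smul_apply, Measure.sum_apply _ MeasurableSet.univ, measure_univ,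
    smul_eq_mul, mul_one]
  rw [← ENNReal.ofReal_tsum_of_nonneg (fun t => pow_nonneg M.γ_nonneg t)
      (summable_geometric_of_lt_one M.γ_nonneg M.γ_lt_one),
    tsum_geometric_of_lt_one M.γ_nonneg M.γ_lt_one, ← ENNReal.ofReal_mul hγ.le,
    mul_inv_cancel₀ hγ.ne', ENNReal.ofReal_one]

theorem hasSum_integral_occupancy {f : S → ℝ} {C : ℝ} (hf : IsBoundedMeasurable f C) :
    HasSum (fun t : ℕ => (1 - M.γ) * (M.γ ^ t * ∫ s, f s ∂(M.stateLaw π ω θ t)))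
      (∫ s, f s ∂(M.occupancy π ω θ)) := by
  have hγ := M.one_sub_γ_pos
  have hint : Integrable f
      (Measure.sum fun t : ℕ => ENNReal.ofReal (M.γ ^ t) • M.stateLaw π ω θ t) := by
    have h := hf.integrable (M.occupancy π ω θ)
    unfold occupancy at h
    rwa [integrable_smul_measure (by simpa using hγ) ENNReal.ofReal_ne_top] at h
  have h := (hasSum_integral_measure hint).mul_left (1 - M.γ)
  unfold occupancy
  rw [integral_smul_measure, ENNReal.toReal_ofReal hγ.le, smul_eq_mul]
  simpa only [integral_smul_measure, ENNReal.toReal_ofReal (pow_nonneg M.γ_nonneg _),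
    smul_eq_mul] using h

/-- The occupancy measure inverts `1 - γ T`, where `T` is the transition operator on states. -/
theorem integral_occupancy_sub {f : S → ℝ} {C : ℝ} (hf : IsBoundedMeasurable f C) :
    ∫ s, (f s - M.γ * ∫ y, f y ∂(M.stepS π ω θ s)) ∂(M.occupancy π ω θ)
      = (1 - M.γ) * ∫ s, f s ∂M.μ := by
  have hT := (hf.integral_kernel (M.stepS π ω θ)).const_mul M.γ
  have h1 := M.hasSum_integral_occupancy π ω θ hf
  have h2 := M.hasSum_integral_occupancy π ω θ hT
  rw [integral_sub (hf.integrable _) (hT.integrable _)]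
  -- Applying the transition operator advances the law by one step, so this series is the series for
  -- `f` without its term `t = 0`.
  have h3 : (fun t : ℕ => (1 - M.γ) * (M.γ ^ t *
      ∫ s, M.γ * ∫ y, f y ∂(M.stepS π ω θ s) ∂(M.stateLaw π ω θ t)))
      = fun t : ℕ => (1 - M.γ) * (M.γ ^ (t + 1) * ∫ s, f s ∂(M.stateLaw π ω θ (t + 1))) := by
    funext t
    rw [integral_const_mul, stateLaw, hf.integral_bind]
    ring
  rw [h3] at h2
  rw [← h1.tsum_eq, ← h2.tsum_eq, h1.summable.tsum_eq_zero_add]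
  simp [stateLaw]

end CMDP

/-! ### Lipschitz estimates in the state, the action and the context -/

theorem NNReal.coe_mul_edist {X : Type*} [PseudoMetricSpace X] (L : ℝ≥0) (x y : X) :
    (L : ℝ≥0∞) * edist x y = ENNReal.ofReal (L * dist x y) := by
  rw [ENNReal.ofReal_mul L.coe_nonneg, ENNReal.ofReal_coe_nnreal, edist_dist]

theorem NNReal.coe_mul_edist_add_edist {X Y : Type*} [PseudoMetricSpace X] [PseudoMetricSpace Y]
    (L : ℝ≥0) (x y : X) (z w : Y) :
    (L : ℝ≥0∞) * (edist x y + edist z w) = ENNReal.ofReal (L * (dist x y + dist z w)) := by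
  rw [ENNReal.ofReal_mul L.coe_nonneg, ENNReal.ofReal_coe_nnreal, edist_dist, edist_dist,
    ENNReal.ofReal_add dist_nonneg dist_nonneg]

section

variable {S A : Type*} [MetricSpace S] [MeasurableSpace S] [MetricSpace A] [MeasurableSpace A]

/-- Averaging a function that is `ℓ`-Lipschitz in the pair over an `L`-Lipschitz kernel gives a
function with Lipschitz constant `(1 + L) ℓ`. -/
theorem abs_integral_kernel_prod_sub_le {κ : Kernel S A} [IsMarkovKernel κ] {L : ℝ≥0}
    (hκ : ∀ s s', kantorovich (κ s) (κ s') ≤ L * edist s s') {f : S × A → ℝ} {C ℓ : ℝ}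
    (hℓ : 0 ≤ ℓ) (hf : IsBoundedMeasurable f C)
    (hfl : ∀ s s' a a', |f (s, a) - f (s', a')| ≤ ℓ * (dist s s' + dist a a')) (s s' : S) :
    |∫ a, f (s, a) ∂(κ s) - ∫ a, f (s', a) ∂(κ s')| ≤ ℓ * (1 + L) * dist s s' := by
  have hs := hf.comp (measurable_prodMk_left (x := s))
  have hs' := hf.comp (measurable_prodMk_left (x := s'))
  have h1 : |∫ a, f (s, a) ∂(κ s) - ∫ a, f (s', a) ∂(κ s)| ≤ ℓ * dist s s' := by
    rw [← integral_sub (hs.integrable _) (hs'.integrable _)]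
    exact ((hs.sub hs').mono fun a => by simpa using hfl s s' a a).abs_integral_le (κ s)
  have h2 : |∫ a, f (s', a) ∂(κ s) - ∫ a, f (s', a) ∂(κ s')| ≤ ℓ * (L * dist s s') :=
    abs_integral_sub_le_of_kantorovich_le (by positivity)
      ((hκ s s').trans_eq (NNReal.coe_mul_edist L s s')) hℓ hs'
      fun a a' => by simpa using hfl s' s' a a'
  have h3 := abs_sub_le (∫ a, f (s, a) ∂(κ s)) (∫ a, f (s', a) ∂(κ s)) (∫ a, f (s', a) ∂(κ s'))
  linarith

namespace CMDP

variable {Ω : Type*} {m : ℕ} {M : CMDP Ω S A} {π : ParametricPolicy m S A}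
  {θ : EuclideanSpace ℝ (Fin m)} {LP Lr : Ω → ℝ≥0} {Lπ : ℝ≥0}

theorem IsLipschitz.abs_integral_P_sub_le (hM : M.IsLipschitz LP Lr) (ω : Ω) {f : S → ℝ} {C ℓ : ℝ}
    (hℓ : 0 ≤ ℓ) (hf : IsBoundedMeasurable f C) (hfl : ∀ s s', |f s - f s'| ≤ ℓ * dist s s')
    (s s' : S) (a a' : A) :
    |∫ y, f y ∂(M.P ω (s, a)) - ∫ y, f y ∂(M.P ω (s', a'))|
      ≤ ℓ * LP ω * (dist s s' + dist a a') := by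
  rw [mul_assoc]
  exact abs_integral_sub_le_of_kantorovich_le (by positivity)
    ((hM.transition ω s s' a a').trans_eq (NNReal.coe_mul_edist_add_edist _ _ _ _ _)) hℓ hf hfl

variable [IsMarkovKernel (π.kernel θ)]

theorem abs_Q_sub_le (hM : M.IsLipschitz LP Lr)
    (hπ : ∀ s s', kantorovich (π.kernel θ s) (π.kernel θ s') ≤ Lπ * edist s s') {ω : Ω}
    (hω : M.γ * LP ω * (1 + Lπ) < 1) (s s' : S) (a a' : A) :
    |M.Q π ω θ s a - M.Q π ω θ s' a'|
      ≤ lipQ M.γ (LP ω) (Lr ω) Lπ * (dist s s' + dist a a') := by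
  rw [mul_assoc] at hω
  unfold lipQ
  rw [mul_assoc M.γ]
  -- The distance is given explicitly: pairs carry the sum of the distances, not the maximum of the
  -- product instance.
  refine lipschitz_of_fixedPoint (M.stepSA π ω θ)
    (d := fun x y : S × A => dist x.1 y.1 + dist x.2 y.2) (fun x y => by positivity)
    M.γ_nonneg M.γ_lt_one hω (Lr ω).coe_nonneg ?_
    (M.isBoundedMeasurable_R ω) (fun x y => hM.reward ω x.1 y.1 x.2 y.2)
    (M.isBoundedMeasurable_Q π ω θ) (M.Q_eq_stepSA π ω θ) (s, a) (s', a')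
  intro f b c hc hf hfl x y
  rw [M.integral_stepSA π ω θ hf, M.integral_stepSA π ω θ hf]
  refine (hM.abs_integral_P_sub_le ω (by positivity) (hf.integral_kernel_prod (π.kernel θ))
    (abs_integral_kernel_prod_sub_le hπ hc hf fun s s' a a' => hfl (s, a) (s', a'))
    x.1 y.1 x.2 y.2).trans_eq ?_
  ring

theorem abs_V_sub_le (hM : M.IsLipschitz LP Lr)
    (hπ : ∀ s s', kantorovich (π.kernel θ s) (π.kernel θ s') ≤ Lπ * edist s s') {ω : Ω}
    (hω : M.γ * LP ω * (1 + Lπ) < 1) (s s' : S) :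
    |M.V π ω θ s - M.V π ω θ s'| ≤ lipV M.γ (LP ω) (Lr ω) Lπ * dist s s' :=
  abs_integral_kernel_prod_sub_le hπ (div_nonneg (Lr ω).coe_nonneg (by linarith))
    (M.isBoundedMeasurable_Q π ω θ) (abs_Q_sub_le hM hπ hω) s s'

variable [MetricSpace Ω] {LωP Lωr : ℝ≥0}

omit [MetricSpace A] [IsMarkovKernel (π.kernel θ)] in
theorem IsContextLipschitz.abs_integral_P_sub_le (hctx : M.IsContextLipschitz LωP Lωr) (ω ω' : Ω)
    {f : S → ℝ} {C ℓ : ℝ} (hℓ : 0 ≤ ℓ) (hf : IsBoundedMeasurable f C)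
    (hfl : ∀ s s', |f s - f s'| ≤ ℓ * dist s s') (x : S × A) :
    |∫ y, f y ∂(M.P ω x) - ∫ y, f y ∂(M.P ω' x)| ≤ ℓ * (LωP * dist ω ω') :=
  abs_integral_sub_le_of_kantorovich_le (by positivity)
    ((hctx.transition ω ω' x.1 x.2).trans_eq (NNReal.coe_mul_edist _ _ _)) hℓ hf hfl

/-- In the difference of the Bellman equations, inserting `∫ V_ω dP_ω'` makes the Lipschitz function
`V_ω` the test function for the two kernels. What is left is `γ` times the unknown supremum, which
is absorbed. -/
theorem abs_Q_sub_Q_le (hM : M.IsLipschitz LP Lr) (hctx : M.IsContextLipschitz LωP Lωr)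
    (hπ : ∀ s s', kantorovich (π.kernel θ s) (π.kernel θ s') ≤ Lπ * edist s s') {ω : Ω}
    (hω : M.γ * LP ω * (1 + Lπ) < 1) (ω' : Ω) (s : S) (a : A) :
    |M.Q π ω θ s a - M.Q π ω' θ s a|
      ≤ lipCtxQ M.γ (LP ω) (Lr ω) Lπ LωP Lωr * dist ω ω' := by
  have hQ := M.isBoundedMeasurable_Q π ω θ
  have hQ' := M.isBoundedMeasurable_Q π ω' θ
  have hV := M.isBoundedMeasurable_V π ω θ
  have hV' := M.isBoundedMeasurable_V π ω' θ
  have hlipV : 0 ≤ lipV M.γ (LP ω) (Lr ω) Lπ :=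
    mul_nonneg (div_nonneg (Lr ω).coe_nonneg (by linarith)) (by positivity)
  have key := abs_le_div_one_sub_of_forall_bound
    (c := Lωr * dist ω ω' + M.γ * (lipV M.γ (LP ω) (Lr ω) Lπ * (LωP * dist ω ω')))
    (hQ.sub hQ').abs_le M.γ_lt_one ?_ (s, a)
  · refine key.trans_eq ?_
    unfold lipCtxQ
    ring
  · rintro b hb ⟨s, a⟩
    have hVV : ∀ s, |M.V π ω θ s - M.V π ω' θ s| ≤ b := fun s => by
      have h1 := hQ.comp (measurable_prodMk_left (x := s))
      have h2 := hQ'.comp (measurable_prodMk_left (x := s))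
      unfold V
      rw [← integral_sub (h1.integrable _) (h2.integrable _)]
      exact ((h1.sub h2).mono fun a => hb (s, a)).abs_integral_le _
    have h3 := hctx.abs_integral_P_sub_le ω ω' hlipV hV (abs_V_sub_le hM hπ hω) (s, a)
    have h4 : |∫ y, M.V π ω θ y ∂(M.P ω' (s, a)) - ∫ y, M.V π ω' θ y ∂(M.P ω' (s, a))| ≤ b := by
      rw [← integral_sub (hV.integrable _) (hV'.integrable _)]
      exact ((hV.sub hV').mono hVV).abs_integral_le _
    have h5 := (abs_sub_le _ _ _).trans (add_le_add h3 h4)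
    have h6 := mul_le_mul_of_nonneg_left h5 M.γ_nonneg
    rw [← abs_of_nonneg M.γ_nonneg, ← abs_mul, abs_of_nonneg M.γ_nonneg] at h6
    change |M.Q π ω θ s a - M.Q π ω' θ s a| ≤ _
    rw [M.Q_eq π ω θ, M.Q_eq π ω' θ]
    calc _ = |(M.R ω (s, a) - M.R ω' (s, a)) + M.γ * (∫ y, M.V π ω θ y ∂(M.P ω (s, a))
          - ∫ y, M.V π ω' θ y ∂(M.P ω' (s, a)))| := by ring_nf
      _ ≤ _ := abs_add_le _ _
      _ ≤ _ := add_le_add (hctx.reward ω ω' s a) h6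
      _ = _ := by ring

/-- Duality moves the problem from the measures to the resolvent `G` of `g` for the context `ω`; the
two occupancy measures then differ only through one transition step applied to `G`. -/
theorem abs_integral_occupancy_sub_le (hM : M.IsLipschitz LP Lr)
    (hctx : M.IsContextLipschitz LωP Lωr)
    (hπ : ∀ s s', kantorovich (π.kernel θ s) (π.kernel θ s') ≤ Lπ * edist s s') {ω : Ω}
    (hω : M.γ * LP ω * (1 + Lπ) < 1) (ω' : Ω) {g : S → ℝ} {C ℓ : ℝ} (hℓ : 0 ≤ ℓ)
    (hg : IsBoundedMeasurable g C) (hgl : ∀ s s', |g s - g s'| ≤ ℓ * dist s s') :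
    |∫ s, g s ∂(M.occupancy π ω θ) - ∫ s, g s ∂(M.occupancy π ω' θ)|
      ≤ ℓ * lipDelta M.γ (LP ω) Lπ LωP * dist ω ω' := by
  have hfix := discountedSum_eq (M.stepS π ω θ) M.γ_nonneg M.γ_lt_one hg
  have hG := isBoundedMeasurable_discountedSum (M.stepS π ω θ) M.γ_nonneg M.γ_lt_one hg
  set G := discountedSum (M.stepS π ω θ) M.γ g
  have hpos : 0 < 1 - M.γ * LP ω * (1 + Lπ) := by linarith
  have hGl : ∀ s s', |G s - G s'| ≤ ℓ / (1 - M.γ * LP ω * (1 + Lπ)) * dist s s' := by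
    rw [mul_assoc] at hω ⊢
    refine lipschitz_of_fixedPoint (M.stepS π ω θ) (fun _ _ => dist_nonneg) M.γ_nonneg
      M.γ_lt_one hω hℓ ?_ hg hgl hG hfix
    intro f b c hc hf hfl s s'
    rw [M.integral_stepS π ω θ hf, M.integral_stepS π ω θ hf]
    refine (abs_integral_kernel_prod_sub_le hπ (by positivity) (hf.integral_kernel (M.P ω))
      (hM.abs_integral_P_sub_le ω hc hf hfl) s s').trans_eq ?_
    ring
  have hT := hG.integral_kernel (M.stepS π ω θ)
  have hT' := hG.integral_kernel (M.stepS π ω' θ)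
  have hTT : ∀ s, |∫ y, G y ∂(M.stepS π ω' θ s) - ∫ y, G y ∂(M.stepS π ω θ s)|
      ≤ ℓ / (1 - M.γ * LP ω * (1 + Lπ)) * (LωP * dist ω ω') := fun s => by
    have h1 := (hG.integral_kernel (M.P ω)).comp (measurable_prodMk_left (x := s))
    have h2 := (hG.integral_kernel (M.P ω')).comp (measurable_prodMk_left (x := s))
    rw [M.integral_stepS π ω θ hG, M.integral_stepS π ω' θ hG,
      ← integral_sub (h2.integrable _) (h1.integrable _)]
    refine ((h2.sub h1).mono fun a => ?_).abs_integral_le _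
    rw [abs_sub_comm]
    exact hctx.abs_integral_P_sub_le ω ω' (by positivity) hG hGl (s, a)
  have hocc : ∫ s, g s ∂(M.occupancy π ω θ) = (1 - M.γ) * ∫ s, G s ∂M.μ := by
    rw [← M.integral_occupancy_sub π ω θ hG]
    exact integral_congr_ae (Filter.Eventually.of_forall fun s => by
      have := hfix s
      simp only
      linarith)
  -- Here `g = (G - γ T' G) + γ (T' - T) G`, and the occupancy measure of `ω'` integrates the first
  -- part to the same value as in `hocc`.
  have hocc' : ∫ s, g s ∂(M.occupancy π ω' θ) = (1 - M.γ) * ∫ s, G s ∂M.μ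
      + M.γ * ∫ s, (∫ y, G y ∂(M.stepS π ω' θ s) - ∫ y, G y ∂(M.stepS π ω θ s))
          ∂(M.occupancy π ω' θ) := by
    rw [← M.integral_occupancy_sub π ω' θ hG, ← integral_const_mul,
      ← integral_add ((hG.sub (hT'.const_mul M.γ)).integrable _)
        (((hT'.sub hT).const_mul M.γ).integrable _)]
    exact integral_congr_ae (Filter.Eventually.of_forall fun s => by
      have := hfix s
      simp only
      linarith)
  rw [hocc, hocc', sub_add_cancel_left, abs_neg, abs_mul, abs_of_nonneg M.γ_nonneg]
  refine (mul_le_mul_of_nonneg_left (((hT'.sub hT).mono hTT).abs_integral_le _)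
    M.γ_nonneg).trans_eq ?_
  unfold lipDelta
  ring

/-- The policy gradient expression is Lipschitz in the context. -/
theorem abs_policyGradient_sub_le (hM : M.IsLipschitz LP Lr)
    (hctx : M.IsContextLipschitz LωP Lωr)
    (hπ : ∀ s s', kantorovich (π.kernel θ s) (π.kernel θ s') ≤ Lπ * edist s s') {i : Fin m}
    {B : ℝ} {Lscore : ℝ≥0}
    (hscore : IsBoundedMeasurable (fun x : S × A => π.score i θ x.1 x.2) B)
    (hscorel : ∀ s s' a a',
      |π.score i θ s a - π.score i θ s' a'| ≤ Lscore * (dist s s' + dist a a')) {ω : Ω}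
    (hω : M.γ * LP ω * (1 + Lπ) < 1) (ω' : Ω) :
    |M.policyGradient π i ω θ - M.policyGradient π i ω' θ|
      ≤ lipGrad M.γ M.Rmax (LP ω) (Lr ω) Lπ LωP Lωr B Lscore * dist ω ω' := by
  obtain ⟨s₀⟩ : Nonempty S := Measure.nonempty_of_neZero M.μ
  obtain ⟨a₀⟩ : Nonempty A := Measure.nonempty_of_neZero (π.kernel θ s₀)
  have hB : 0 ≤ B := (abs_nonneg _).trans (hscore.abs_le (s₀, a₀))
  have hR : 0 ≤ M.Rmax := (abs_nonneg _).trans (M.abs_R_le ω (s₀, a₀))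
  have hγ := M.one_sub_γ_pos
  have hlipQ : 0 ≤ lipQ M.γ (LP ω) (Lr ω) Lπ := div_nonneg (Lr ω).coe_nonneg (by linarith)
  have hη : ∀ ω, IsBoundedMeasurable (fun x : S × A => M.eta π i ω θ x.1 x.2)
    (B * (M.Rmax / (1 - M.γ))) := fun ω => hscore.mul (M.isBoundedMeasurable_Q π ω θ)
  have hlipη : 0 ≤ lipEta M.γ M.Rmax (LP ω) (Lr ω) Lπ B Lscore := by
    unfold lipEta; positivity
  have hηl : ∀ s s' a a', |M.eta π i ω θ s a - M.eta π i ω θ s' a'|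
      ≤ lipEta M.γ M.Rmax (LP ω) (Lr ω) Lπ B Lscore * (dist s s' + dist a a') := by
    intro s s' a a'
    have h1 := abs_Q_sub_le hM hπ hω s s' a a'
    have h2 := hscorel s s' a a'
    have h3 := (M.isBoundedMeasurable_Q π ω θ).abs_le (s, a)
    have h4 := hscore.abs_le (s', a')
    -- Product rule: `Q` is bounded by `Rmax / (1 - γ)` and the score by `B`, whence the two terms
    -- of `lipEta`.
    calc _ = |(π.score i θ s a - π.score i θ s' a') * M.Q π ω θ s a
          + π.score i θ s' a' * (M.Q π ω θ s a - M.Q π ω θ s' a')| := by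
            unfold eta; ring_nf
      _ ≤ _ := abs_add_le _ _
      _ ≤ Lscore * (dist s s' + dist a a') * (M.Rmax / (1 - M.γ))
          + B * (lipQ M.γ (LP ω) (Lr ω) Lπ * (dist s s' + dist a a')) := by
            rw [abs_mul, abs_mul]
            gcongr
      _ = _ := by unfold lipEta; ring
  have hg := fun ω => (hη ω).integral_kernel_prod (π.kernel θ)
  -- Change of measure with the integrand of `ω` kept; `h2` below changes the integrand.
  have h1 := abs_integral_occupancy_sub_le hM hctx hπ hω ω' (by positivity) (hg ω)
    (abs_integral_kernel_prod_sub_le hπ hlipη (hη ω) hηl)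
  have hgg : ∀ s, |∫ a, M.eta π i ω θ s a ∂(π.kernel θ s)
      - ∫ a, M.eta π i ω' θ s a ∂(π.kernel θ s)|
      ≤ B * (lipCtxQ M.γ (LP ω) (Lr ω) Lπ LωP Lωr * dist ω ω') := fun s => by
    have h2 := (hη ω).comp (measurable_prodMk_left (x := s))
    have h3 := (hη ω').comp (measurable_prodMk_left (x := s))
    rw [← integral_sub (h2.integrable _) (h3.integrable _)]
    refine ((h2.sub h3).mono fun a => ?_).abs_integral_le _
    simp only [eta]
    rw [← mul_sub, abs_mul]
    exact mul_le_mul (hscore.abs_le (s, a)) (abs_Q_sub_Q_le hM hctx hπ hω ω' s a)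
      (abs_nonneg _) hB
  have h2 : |∫ s, ∫ a, M.eta π i ω θ s a ∂(π.kernel θ s) ∂(M.occupancy π ω' θ)
      - ∫ s, ∫ a, M.eta π i ω' θ s a ∂(π.kernel θ s) ∂(M.occupancy π ω' θ)|
      ≤ B * (lipCtxQ M.γ (LP ω) (Lr ω) Lπ LωP Lωr * dist ω ω') := by
    rw [← integral_sub ((hg ω).integrable _) ((hg ω').integrable _)]
    exact (((hg ω).sub (hg ω')).mono hgg).abs_integral_le _
  refine ((abs_sub_le _ _ _).trans (add_le_add h1 h2)).trans_eq ?_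
  unfold lipGrad
  ring

end CMDP

end

/-! ### Importance weights and their first-order expansion -/

namespace ParametricPolicy

variable {m : ℕ} {S A : Type*} [MeasurableSpace S] [MeasurableSpace A]
  {π : ParametricPolicy m S A} {θ θ' : EuclideanSpace ℝ (Fin m)}

/-- The importance weight minus one. -/
noncomputable def relDiff (π : ParametricPolicy m S A) (θ θ' : EuclideanSpace ℝ (Fin m))
    (s : S) (a : A) : ℝ :=
  π.density θ' s a / π.density θ s a - 1

theorem measurable_relDiff (hθ : θ ∈ π.Θ) (hθ' : θ' ∈ π.Θ) :
    Measurable fun x : S × A => π.relDiff θ θ' x.1 x.2 :=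
  ((π.measurable_density θ' hθ').div (π.measurable_density θ hθ)).sub_const 1

/-- Change of policy by importance weighting. -/
theorem integral_kernel_eq (hθ : θ ∈ π.Θ) (hθ' : θ' ∈ π.Θ) (s : S) (f : A → ℝ) :
    ∫ a, f a ∂(π.kernel θ' s) = ∫ a, f a * (1 + π.relDiff θ θ' s a) ∂(π.kernel θ s) := by
  have hm : ∀ θ ∈ π.Θ, Measurable fun a => ENNReal.ofReal (π.density θ s a) := fun θ hθ =>
    ((π.measurable_density θ hθ).comp measurable_prodMk_left).ennreal_ofReal
  rw [π.kernel_apply hθ, π.kernel_apply hθ',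
    integral_withDensity_eq_integral_toReal_smul (hm θ' hθ') (by simp),
    integral_withDensity_eq_integral_toReal_smul (hm θ hθ) (by simp)]
  refine integral_congr_ae (Filter.Eventually.of_forall fun a => ?_)
  have h := π.density_pos θ hθ s a
  simp only [ENNReal.toReal_ofReal h.le, ENNReal.toReal_ofReal (π.density_pos θ' hθ' s a).le,
    relDiff, smul_eq_mul]
  field_simp
  ring

theorem exists_add_smul_mem (hθ : θ ∈ π.Θ) (i : Fin m) :
    ∃ r > 0, ∀ h : ℝ, |h| < r → θ + h • EuclideanSpace.single i (1 : ℝ) ∈ π.Θ := by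
  obtain ⟨r, hr, hball⟩ := Metric.isOpen_iff.1 π.isOpen_Θ θ hθ
  refine ⟨r, hr, fun h hh => hball ?_⟩
  simpa [Metric.mem_ball, dist_eq_norm, norm_smul] using hh

/-- The score is a pointwise limit of difference quotients along a sequence that stays in `Θ`.
Lipschitz continuity would not suffice: the product of the Borel σ-algebras may be smaller than the
Borel σ-algebra of the product. -/
theorem measurable_score {i : Fin m} (hθ : θ ∈ π.Θ)
    (hdiff : ∀ s a, LineDifferentiableAt ℝ (π.logDensity s a) θ (EuclideanSpace.single i 1)) :
    Measurable fun x : S × A => π.score i θ x.1 x.2 := by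
  obtain ⟨r, hr, hmem⟩ := π.exists_add_smul_mem hθ i
  have hpos : ∀ n : ℕ, 0 < r / 2 * (1 / ((n : ℝ) + 1)) := fun n => by positivity
  have hlt : ∀ n : ℕ, |r / 2 * (1 / ((n : ℝ) + 1))| < r := fun n => by
    rw [abs_of_pos (hpos n)]
    have : 1 / ((n : ℝ) + 1) ≤ 1 := by
      rw [div_le_one (by positivity)]
      have : (0 : ℝ) ≤ n := n.cast_nonneg
      linarith
    nlinarith
  have htend : Filter.Tendsto (fun n : ℕ => r / 2 * (1 / ((n : ℝ) + 1))) Filter.atTop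
      (nhdsWithin 0 {0}ᶜ) := by
    refine tendsto_nhdsWithin_iff.2 ⟨?_, Filter.Eventually.of_forall fun n => (hpos n).ne'⟩
    simpa using tendsto_one_div_add_atTop_nhds_zero_nat.const_mul (r / 2)
  refine measurable_of_tendsto_metrizable (fun n : ℕ => ?_) (tendsto_pi_nhds.2 fun x : S × A =>
    (hdiff x.1 x.2).hasLineDerivAt.tendsto_slope_zero.comp htend)
  have hlog : ∀ θ ∈ π.Θ, Measurable fun x : S × A => π.logDensity x.1 x.2 θ := fun θ hθ =>
    (π.measurable_density θ hθ).log
  exact ((hlog _ (hmem _ (hlt n))).sub (hlog θ hθ)).const_mul _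

end ParametricPolicy

namespace ParametricPolicy.HasLipschitzScore

variable {m : ℕ} {S A : Type*} [MetricSpace S] [MeasurableSpace S]
  [MetricSpace A] [MeasurableSpace A] {π : ParametricPolicy m S A}
  {θ : EuclideanSpace ℝ (Fin m)} {B : EuclideanSpace ℝ (Fin m) → Fin m → ℝ}
  {Lscore Lparam : EuclideanSpace ℝ (Fin m) → Fin m → ℝ≥0}

theorem isBoundedMeasurable_score (hscore : π.HasLipschitzScore B Lscore Lparam)
    (hθ : θ ∈ π.Θ) (i : Fin m) :
    IsBoundedMeasurable (fun x : S × A => π.score i θ x.1 x.2) (B θ i) :=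
  ⟨measurable_score hθ (hscore.differentiable θ hθ i),
    fun x => hscore.bounded θ hθ i x.1 x.2⟩

/-- First-order expansion of the log-density, uniform in the state-action pair. -/
theorem abs_logDensity_sub_le (hscore : π.HasLipschitzScore B Lscore Lparam) {i : Fin m}
    (hθ : θ ∈ π.Θ) {r : ℝ}
    (hr : ∀ h : ℝ, |h| < r → θ + h • EuclideanSpace.single i (1 : ℝ) ∈ π.Θ) {h : ℝ}
    (hh : |h| < r) (s : S) (a : A) :
    |π.logDensity s a (θ + h • EuclideanSpace.single i (1 : ℝ)) - π.logDensity s a θ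
      - h * π.score i θ s a| ≤ Lparam θ i * h ^ 2 := by
  set e : EuclideanSpace ℝ (Fin m) := EuclideanSpace.single i 1 with he
  have hderiv : ∀ t : ℝ, |t| < r → HasDerivAt
      (fun t : ℝ => π.logDensity s a (θ + t • e) - t * π.score i θ s a)
      (π.score i (θ + t • e) s a - π.score i θ s a) t := fun t ht => by
    have h1 : HasDerivAt (fun u : ℝ => π.logDensity s a ((θ + t • e) + u • e))
        (π.score i (θ + t • e) s a) 0 :=
      (hscore.differentiable _ (hr t ht) i s a).hasLineDerivAt
    have h2 : HasDerivAt (fun u : ℝ => π.logDensity s a (θ + u • e))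
        (π.score i (θ + t • e) s a) t := by
      have h3 := HasDerivAt.comp_sub_const t t (by simpa using h1)
      refine h3.congr_of_eventuallyEq (Filter.Eventually.of_forall fun u => ?_)
      simp only [add_assoc, ← add_smul, add_sub_cancel]
    exact h2.sub (hasDerivAt_mul_const _)
  -- Mean value inequality after removing the linear part: the derivative is a difference of scores
  -- at parameters at distance at most `|h|`.
  have key := Convex.norm_image_sub_le_of_norm_hasDerivWithin_le (s := Metric.closedBall 0 |h|)
    (x := (0 : ℝ)) (y := h) (C := Lparam θ i * |h|)
    (fun t ht => (hderiv t ((by simpa using ht : |t| ≤ |h|).trans_lt hh)).hasDerivWithinAt)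
    (fun t ht => ?_) (convex_closedBall _ _) (by simp) (by simp)
  · have h1 : Lparam θ i * |h| * |h| = Lparam θ i * h ^ 2 := by rw [mul_assoc, abs_mul_abs_self, sq]
    simp only [Real.norm_eq_abs, zero_smul, add_zero, zero_mul, sub_zero, h1] at key
    convert key using 2
    ring
  · have ht' : |t| ≤ |h| := by simpa using ht
    rw [Real.norm_eq_abs, abs_sub_comm]
    refine (hscore.param θ hθ _ (hr t (ht'.trans_lt hh)) i s a).trans ?_
    refine mul_le_mul_of_nonneg_left ?_ (Lparam θ i).coe_nonneg
    simpa [dist_eq_norm, norm_smul, he] using ht'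

/-- First-order expansion of the importance weights, uniform in the state-action pair. -/
theorem exists_relDiff_expansion (hscore : π.HasLipschitzScore B Lscore Lparam)
    (hθ : θ ∈ π.Θ) (i : Fin m) (hB : 0 ≤ B θ i) :
    ∃ K : ℝ, ∃ r > 0, 0 ≤ K ∧ r ≤ 1 ∧ ∀ h : ℝ, |h| < r →
      θ + h • EuclideanSpace.single i (1 : ℝ) ∈ π.Θ ∧ ∀ s a,
        |π.relDiff θ (θ + h • EuclideanSpace.single i (1 : ℝ)) s a - h * π.score i θ s a|
          ≤ K * h ^ 2 := by
  obtain ⟨r, hr, hmem⟩ := π.exists_add_smul_mem hθ i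
  set D : ℝ := B θ i + Lparam θ i with hD
  have hD0 : 0 ≤ D := by positivity
  -- `D` bounds the log-ratio by `D |h|`, and `r ≤ 1 / (D + 1)` keeps it below `1`, where `|exp x -
  -- 1 - x| ≤ x ^ 2`. In `K`, `D ^ 2` comes from the exponential and `Lparam θ i` from the
  -- logarithm.
  refine ⟨D ^ 2 + Lparam θ i, min r (1 / (D + 1)), by positivity, by positivity,
    (min_le_right _ _).trans ((div_le_one (by positivity)).2 (by linarith)), fun h hh => ?_⟩
  have hhr : |h| < r := hh.trans_le (min_le_left _ _)
  have hhD : |h| * (D + 1) < 1 := (lt_div_iff₀ (by positivity)).1 (hh.trans_le (min_le_right _ _))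
  have hh0 := abs_nonneg h
  have hh1 : |h| ≤ 1 := by nlinarith
  refine ⟨hmem h hhr, fun s a => ?_⟩
  have hlog := hscore.abs_logDensity_sub_le hθ hmem hhr s a
  set x := π.logDensity s a (θ + h • EuclideanSpace.single i (1 : ℝ)) - π.logDensity s a θ with hx
  have hratio : π.relDiff θ (θ + h • EuclideanSpace.single i (1 : ℝ)) s a = Real.exp x - 1 := by
    rw [hx, Real.exp_sub]
    simp only [logDensity, relDiff]
    rw [Real.exp_log (π.density_pos _ (hmem h hhr) s a), Real.exp_log (π.density_pos _ hθ s a)]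
  have hxD : |x| ≤ D * |h| := by
    have h1 : |h * π.score i θ s a| ≤ |h| * B θ i := by
      rw [abs_mul]
      exact mul_le_mul_of_nonneg_left (hscore.bounded θ hθ i s a) hh0
    have h2 : (Lparam θ i : ℝ) * h ^ 2 ≤ Lparam θ i * |h| := by
      refine mul_le_mul_of_nonneg_left ?_ (Lparam θ i).coe_nonneg
      rw [← sq_abs]
      nlinarith
    have h3 := abs_add_le (x - h * π.score i θ s a) (h * π.score i θ s a)
    rw [sub_add_cancel] at h3
    rw [hD]
    linarith
  have hexp := Real.abs_exp_sub_one_sub_id_le (x := x) (by nlinarith)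
  have hx2 : x ^ 2 ≤ D ^ 2 * h ^ 2 := by
    rw [← sq_abs x, ← sq_abs h, ← mul_pow]
    exact pow_le_pow_left₀ (abs_nonneg x) hxD 2
  rw [hratio]
  have h4 := abs_add_le (Real.exp x - 1 - x) (x - h * π.score i θ s a)
  rw [sub_add_sub_cancel] at h4
  linarith

end ParametricPolicy.HasLipschitzScore

/-! ### The policy gradient theorem -/

namespace CMDP

variable {Ω S A : Type*} [MeasurableSpace S] [MeasurableSpace A] {m : ℕ}
  {M : CMDP Ω S A} {π : ParametricPolicy m S A} {θ θ' : EuclideanSpace ℝ (Fin m)}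

theorem V_eq_importance (hθ : θ ∈ π.Θ) (hθ' : θ' ∈ π.Θ) (ω : Ω) {ε : ℝ}
    (hε : ∀ s a, |π.relDiff θ θ' s a| ≤ ε) (s : S) :
    M.V π ω θ' s = ∫ a, M.Q π ω θ' s a ∂(π.kernel θ s)
      + ∫ a, M.Q π ω θ' s a * π.relDiff θ θ' s a ∂(π.kernel θ s) := by
  have := π.isMarkovKernel_kernel hθ
  have := π.isMarkovKernel_kernel hθ'
  have hQ := (M.isBoundedMeasurable_Q π ω θ').comp (measurable_prodMk_left (x := s))
  have he : IsBoundedMeasurable (π.relDiff θ θ' s) ε :=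
    ⟨(π.measurable_relDiff hθ hθ').comp measurable_prodMk_left, hε s⟩
  rw [V, π.integral_kernel_eq hθ hθ', ← integral_add (hQ.integrable _) ((hQ.mul he).integrable _)]
  simp only [mul_add, mul_one]

/-- First-order expansion of the return in the policy, with explicit remainder. -/
theorem abs_expectedReturn_sub_le (hθ : θ ∈ π.Θ) (hθ' : θ' ∈ π.Θ) (ω : Ω) {i : Fin m}
    {b c ε h : ℝ} (hscore : IsBoundedMeasurable (fun x : S × A => π.score i θ x.1 x.2) b)
    (hε : ∀ s a, |π.relDiff θ θ' s a| ≤ ε)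
    (hc : ∀ s a, |π.relDiff θ θ' s a - h * π.score i θ s a| ≤ c) :
    |(1 - M.γ) * M.expectedReturn π ω θ' - (1 - M.γ) * M.expectedReturn π ω θ
        - h * M.policyGradient π i ω θ|
      ≤ M.Rmax / (1 - M.γ) * c + |h| * b * (M.Rmax / (1 - M.γ) * ε / (1 - M.γ)) := by
  have := π.isMarkovKernel_kernel hθ
  have := π.isMarkovKernel_kernel hθ'
  obtain ⟨s₀⟩ : Nonempty S := Measure.nonempty_of_neZero M.μ
  obtain ⟨a₀⟩ : Nonempty A := Measure.nonempty_of_neZero (π.kernel θ s₀)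
  have hb0 : 0 ≤ b := (abs_nonneg _).trans (hscore.abs_le (s₀, a₀))
  have hε0 : 0 ≤ ε := (abs_nonneg _).trans (hε s₀ a₀)
  have hR0 : 0 ≤ M.Rmax := (abs_nonneg _).trans (M.abs_R_le ω (s₀, a₀))
  have hγ0 := M.γ_nonneg
  have hγ := M.one_sub_γ_pos
  have hQ := M.isBoundedMeasurable_Q π ω θ
  have hQ' := M.isBoundedMeasurable_Q π ω θ'
  have hV := M.isBoundedMeasurable_V π ω θ
  have hV' := M.isBoundedMeasurable_V π ω θ'
  have he : IsBoundedMeasurable (fun x : S × A => π.relDiff θ θ' x.1 x.2) ε :=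
    ⟨π.measurable_relDiff hθ hθ', fun x => hε x.1 x.2⟩
  have hQe := hQ'.mul he
  have hu := hQe.integral_kernel_prod (π.kernel θ)
  have hW := hV'.sub hV
  -- With `hQQ`, this is a resolvent equation for the difference of the values: the source is the
  -- reweighted `Q` at `θ'`, the transitions are those of `θ`.
  have hWs : ∀ s, M.V π ω θ' s - M.V π ω θ s
      = ∫ a, M.Q π ω θ' s a * π.relDiff θ θ' s a ∂(π.kernel θ s)
        + ∫ a, (M.Q π ω θ' s a - M.Q π ω θ s a) ∂(π.kernel θ s) := fun s => by
    rw [V_eq_importance hθ hθ' ω hε, V, integral_sub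
      ((hQ'.comp (measurable_prodMk_left (x := s))).integrable _)
      ((hQ.comp (measurable_prodMk_left (x := s))).integrable _)]
    ring
  have hQQ : ∀ s a, M.Q π ω θ' s a - M.Q π ω θ s a
      = M.γ * ∫ y, (M.V π ω θ' y - M.V π ω θ y) ∂(M.P ω (s, a)) := fun s a => by
    rw [M.Q_eq π ω θ, M.Q_eq π ω θ', integral_sub (hV'.integrable _) (hV.integrable _)]
    ring
  have hQb : ∀ d, (∀ s, |M.V π ω θ' s - M.V π ω θ s| ≤ d) →
      ∀ s a, |M.Q π ω θ' s a - M.Q π ω θ s a| ≤ M.γ * d := fun d hd s a => by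
    rw [hQQ, abs_mul, abs_of_nonneg hγ0]
    exact mul_le_mul_of_nonneg_left ((hW.mono hd).abs_integral_le _) hγ0
  have hWb : ∀ s, |M.V π ω θ' s - M.V π ω θ s| ≤ M.Rmax / (1 - M.γ) * ε / (1 - M.γ) := by
    refine abs_le_div_one_sub_of_forall_bound hW.abs_le M.γ_lt_one fun d hd s => ?_
    rw [hWs]
    refine (abs_add_le _ _).trans (add_le_add (hu.abs_le s) ?_)
    exact (((hQ'.sub hQ).comp (measurable_prodMk_left (x := s))).mono
      (hQb d hd s)).abs_integral_le _
  have hQb' : ∀ s a, |M.Q π ω θ' s a - M.Q π ω θ s a|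
      ≤ M.Rmax / (1 - M.γ) * ε / (1 - M.γ) := fun s a =>
    (hQb _ hWb s a).trans
      (mul_le_of_le_one_left (by positivity) M.γ_lt_one.le)
  -- Performance difference identity: the occupancy measure of `θ` integrates that equation down to
  -- its source.
  have hdual : (1 - M.γ) * M.expectedReturn π ω θ' - (1 - M.γ) * M.expectedReturn π ω θ
      = ∫ s, ∫ a, M.Q π ω θ' s a * π.relDiff θ θ' s a ∂(π.kernel θ s)
          ∂(M.occupancy π ω θ) := by
    rw [← mul_sub, expectedReturn, expectedReturn,
      ← integral_sub (hV'.integrable _) (hV.integrable _), ← M.integral_occupancy_sub π ω θ hW]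
    refine integral_congr_ae (Filter.Eventually.of_forall fun s => ?_)
    simp only
    rw [M.integral_stepS π ω θ hW, hWs s]
    simp only [hQQ]
    rw [integral_const_mul]
    ring
  have hη : IsBoundedMeasurable (fun x : S × A => M.eta π i ω θ x.1 x.2)
    (b * (M.Rmax / (1 - M.γ))) := hscore.mul hQ
  have hg := hη.integral_kernel_prod (π.kernel θ)
  rw [hdual, policyGradient, ← integral_const_mul,
    ← integral_sub (hu.integrable _) ((hg.const_mul h).integrable _)]
  refine ((hu.sub (hg.const_mul h)).mono fun s => ?_).abs_integral_le _
  have h1 := hQe.comp (measurable_prodMk_left (x := s))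
  have h2 := (hη.comp (measurable_prodMk_left (x := s))).const_mul h
  simp only
  rw [← integral_const_mul, ← integral_sub (h1.integrable _) (h2.integrable _)]
  refine ((h1.sub h2).mono fun a => ?_).abs_integral_le _
  simp only [eta]
  -- The first term is the error of the weight expansion; the second is a product of two first-order
  -- quantities.
  calc _ = |M.Q π ω θ' s a * (π.relDiff θ θ' s a - h * π.score i θ s a)
        + h * π.score i θ s a * (M.Q π ω θ' s a - M.Q π ω θ s a)| := by ring_nf
    _ ≤ _ := abs_add_le _ _
    _ ≤ _ := by
      rw [abs_mul, abs_mul, abs_mul]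
      have h3 := hQ'.abs_le (s, a)
      have h4 := hscore.abs_le (s, a)
      have h5 := hc s a
      have h6 := hQb' s a
      gcongr

/-- The policy gradient theorem. -/
theorem hasLineDerivAt_expectedReturn (hθ : θ ∈ π.Θ) (ω : Ω) {i : Fin m} {b K r : ℝ}
    (hK : 0 ≤ K) (hr : 0 < r) (hr1 : r ≤ 1)
    (hscore : IsBoundedMeasurable (fun x : S × A => π.score i θ x.1 x.2) b)
    (hexp : ∀ h : ℝ, |h| < r → θ + h • EuclideanSpace.single i (1 : ℝ) ∈ π.Θ ∧ ∀ s a,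
        |π.relDiff θ (θ + h • EuclideanSpace.single i (1 : ℝ)) s a - h * π.score i θ s a|
          ≤ K * h ^ 2) :
    HasLineDerivAt ℝ (fun θ' => (1 - M.γ) * M.expectedReturn π ω θ')
      (M.policyGradient π i ω θ) θ (EuclideanSpace.single i 1) := by
  rw [hasLineDerivAt_iff_isLittleO_nhds_zero]
  -- An `O(t²)` remainder suffices; the constant is that of `abs_expectedReturn_sub_le` for `c = K
  -- h²` and `ε = (K + b) |h|`.
  refine Asymptotics.IsBigO.trans_isLittleO (g := fun t : ℝ => t ^ 2) ?_
    (Asymptotics.isLittleO_pow_id one_lt_two)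
  refine Asymptotics.IsBigO.of_bound (M.Rmax / (1 - M.γ) * K
    + b * (M.Rmax / (1 - M.γ) * (K + b) / (1 - M.γ))) ?_
  filter_upwards [Metric.ball_mem_nhds (0 : ℝ) hr] with h hh
  have hhr : |h| < r := by simpa using hh
  obtain ⟨hmem, hK'⟩ := hexp h hhr
  have hε : ∀ s a, |π.relDiff θ (θ + h • EuclideanSpace.single i (1 : ℝ)) s a|
      ≤ (K + b) * |h| := fun s a => by
    have h1 : |h * π.score i θ s a| ≤ |h| * b := by
      rw [abs_mul]
      exact mul_le_mul_of_nonneg_left (hscore.abs_le (s, a)) (abs_nonneg h)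
    have h2 : K * h ^ 2 ≤ K * |h| := by
      refine mul_le_mul_of_nonneg_left ?_ hK
      rw [← sq_abs]
      nlinarith [abs_nonneg h]
    have h3 := abs_add_le (π.relDiff θ (θ + h • EuclideanSpace.single i (1 : ℝ)) s a
      - h * π.score i θ s a) (h * π.score i θ s a)
    rw [sub_add_cancel] at h3
    linarith [hK' s a]
  have key := M.abs_expectedReturn_sub_le hθ hmem ω hscore hε hK'
  rw [Real.norm_eq_abs, smul_eq_mul, Real.norm_eq_abs, abs_of_nonneg (sq_nonneg h)]
  refine key.trans_eq ?_
  rw [← sq_abs h]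
  ring

end CMDP

theorem theorem2
    {Ω S A : Type*} [MetricSpace Ω]
    [MetricSpace S] [MeasurableSpace S] [BorelSpace S]
    [MetricSpace A] [MeasurableSpace A] [BorelSpace A]
    {m : ℕ} (M : CMDP Ω S A) (π : ParametricPolicy m S A)
    (LP Lr : Ω → ℝ≥0) (LωP Lωr : ℝ≥0)
    (Lπ Lπparam : EuclideanSpace ℝ (Fin m) → ℝ≥0)
    (B : EuclideanSpace ℝ (Fin m) → Fin m → ℝ)
    (Lscore Lscoreparam : EuclideanSpace ℝ (Fin m) → Fin m → ℝ≥0)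
    (hM : M.IsLipschitz LP Lr)
    (hctx : M.IsContextLipschitz LωP Lωr)
    (hπ : π.IsLipschitz Lπ Lπparam)
    (hscore : π.HasLipschitzScore B Lscore Lscoreparam)
    (θ : EuclideanSpace ℝ (Fin m)) (hθ : θ ∈ π.Θ)
    (ω : Ω) (hω : M.γ * LP ω * (1 + Lπ θ) < 1) (i : Fin m) :
    -- the normalized return has an `i`-th partial derivative at `θ`, in every context
    (∀ ω' : Ω, HasLineDerivAt ℝ (fun θ' => (1 - M.γ) * M.expectedReturn π ω' θ')
      (M.policyGradient π i ω' θ) θ (EuclideanSpace.single i 1)) ∧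
    -- and this derivative is Lipschitz in the context
    ∀ ω' : Ω, |M.policyGradient π i ω θ - M.policyGradient π i ω' θ| ≤
      lipGrad M.γ M.Rmax (LP ω) (Lr ω) (Lπ θ) LωP Lωr (B θ i) (Lscore θ i) * dist ω ω' := by
  have := π.isMarkovKernel_kernel hθ
  have hbm := hscore.isBoundedMeasurable_score hθ i
  -- A point of `S × A` is needed to see that `B θ i` is nonnegative.
  obtain ⟨s₀⟩ : Nonempty S := Measure.nonempty_of_neZero M.μ
  obtain ⟨a₀⟩ : Nonempty A := Measure.nonempty_of_neZero (π.kernel θ s₀)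
  obtain ⟨K, r, hr, hK, hr1, hexp⟩ := hscore.exists_relDiff_expansion hθ i
    ((abs_nonneg _).trans (hbm.abs_le (s₀, a₀)))
  exact ⟨fun ω' => CMDP.hasLineDerivAt_expectedReturn hθ ω' hK hr hr1 hbm hexp,
    fun ω' => CMDP.abs_policyGradient_sub_le hM hctx (hπ.state θ hθ) hbm
      (hscore.stateAction θ hθ i) hω ω'⟩
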